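/- Let $X$ be a finite set of $n\ge 2$ points in the Euclidean plane and let $k\ge 0$ be an integer. A *network* on $X$ with $k$ Steiner points consists of locations $s_1,\dots,s_k\in\mathbb{R}^2$ and a finite simple graph $N$ that is $2$-connected (connected, and still connected after the removal of any single vertex; $K_1$ and $K_2$ count as $2$-connected) and whose vertex set $V(N)$ consists of the $n$ points of $X$ and $k$ further labelled vertices (the Steiner points), located at $s_1,\dots,s_k$; the location of a Steiner point is allowed to coincide with that of another vertex. Call the network *proper* if its $n+k$ vertices have pairwise distinct locations. Let $\ell_{\max}(N)$ be the length of a longest edge of $N$. A *$(2,k)$-MBSN* on $X$ is a network whose $\ell_{\max}$ is minimum among all networks on $X$ with $k$ Steiner points; a *proper $(2,k)$-MBSN* is a proper network whose $\ell_{\max}$ is minimum among all proper networks on $X$ with $k$ Steiner points. The *$2$-relative neighbourhood graph* ($2$-RNG) on a set $V$ of vertices located in the plane is the graph on $V$ in which two distinct vertices $u,v$ are adjacent if and only if fewer than two vertices of $V$ lie strictly inside both circles of radius $|uv|$ centred at $u$ and at $v$. Then there is a $(2,k)$-MBSN $N_k$ on $X$ that is a subgraph of the $2$-RNG on $V(N_k)$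 and in which every vertex has degree at most $5$. Moreover, if a proper $(2,k)$-MBSN on $X$ exists, then there is a proper $(2,k)$-MBSN $N_k$ on $X$ that is a subgraph of the $2$-RNG on $V(N_k)$ and in which every vertex has degree at most $5$. -/

import Mathlib

/-- The Euclidean plane. -/
abbrev Plane : Type := EuclideanSpace ℝ (Fin 2)

/-- `G` is 2-connected: it is connected, and it stays connected when any one vertex is removed.
The graphs `K₁` and `K₂` count as 2-connected (removing a vertex then leaves at most one vertex). -/
def TwoConnected {V : Type} (G : SimpleGraph V) : Prop :=
  G.Connected ∧ ∀ v : V, (G.induce {v}ᶜ).Preconnected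

/-- The length `ℓ_max` of a longest edge of the graph `G` drawn with vertex positions `p`
(`0` if there is no edge). -/
noncomputable def maxEdgeLength {V : Type} (p : V → Plane) (G : SimpleGraph V) : ℝ :=
  sSup {r : ℝ | ∃ u v : V, G.Adj u v ∧ r = dist (p u) (p v)}

/-- The (open) lune specified by the segment `ab`: the points strictly inside both circles of
radius `|ab|` centred at `a` and at `b`. -/
def lune (a b : Plane) : Set Plane :=
  Metric.ball a (dist a b) ∩ Metric.ball b (dist a b)

/-- The 2-relative neighbourhood graph on the vertices `V` located at `p`: two distinct vertices
are adjacent iff the lune they specify contains fewer than two of the vertices. -/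
def twoRNG {V : Type} (p : V → Plane) : SimpleGraph V where
  Adj u v := u ≠ v ∧ {w : V | p w ∈ lune (p u) (p v)}.encard < 2
  symm := ⟨fun u v h => ⟨h.1.symm, by
    have h2 := h.2
    simpa only [lune, dist_comm (p v) (p u), Set.inter_comm] using h2⟩⟩
  loopless := ⟨fun _ h => h.1 rfl⟩

/-- A 2-connected network spanning the points of `X` and `k` Steiner points. Its vertices are the
points of `X` together with `k` labelled Steiner points, which may be located anywhere. -/
structure SteinerNetwork (X : Finset Plane) (k : ℕ) where
  /-- the locations of the Steiner points -/
  steiner : Fin k → Plane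
  /-- the topology of the network -/
  graph : SimpleGraph (↥X ⊕ Fin k)
  twoConnected : TwoConnected graph

namespace SteinerNetwork

variable {X : Finset Plane} {k : ℕ}

/-- The location of a vertex of the network. -/
def pos (N : SteinerNetwork X k) : ↥X ⊕ Fin k → Plane :=
  Sum.elim (fun x => (x : Plane)) N.steiner

/-- The bottleneck of the network: the length of its longest edge. -/
noncomputable def bottleneck (N : SteinerNetwork X k) : ℝ :=
  maxEdgeLength N.pos N.graph

/-- The network is a `(2,k)`-MBSN on `X`: its bottleneck is minimum among all 2-connected networks
spanning `X` and `k` Steiner points. -/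
def IsMBSN (N : SteinerNetwork X k) : Prop :=
  ∀ N' : SteinerNetwork X k, N.bottleneck ≤ N'.bottleneck

/-- The vertices of the network have pairwise distinct locations: the Steiner points are
`k` distinct points outside `X`. -/
def IsProper (N : SteinerNetwork X k) : Prop :=
  Function.Injective N.pos

/-- The network is proper and its bottleneck is minimum among all proper 2-connected networks
spanning `X` and `k` Steiner points. -/
def IsProperMBSN (N : SteinerNetwork X k) : Prop :=
  N.IsProper ∧ ∀ N' : SteinerNetwork X k, N'.IsProper → N.bottleneck ≤ N'.bottleneck

/-- The network is a subgraph of the 2-relative neighbourhood graph on its own vertices. -/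
def IsSubgraphOfTwoRNG (N : SteinerNetwork X k) : Prop :=
  N.graph ≤ twoRNG N.pos

/-- Every vertex of the network (Steiner or not) has at most `d` neighbours. -/
def MaxDegreeLE (N : SteinerNetwork X k) (d : ℕ) : Prop :=
  ∀ v : ↥X ⊕ Fin k, (N.graph.neighborSet v).encard ≤ d

end SteinerNetwork

/-! With the locations fixed, any 2-connected network can be improved without lengthening its
longest edge; applied to an optimal network, this gives both claims, properness depending only on
the locations.

Among the 2-connected graphs with all edges at most `B`, take one of least weight, where an edge
outweighs any four shorter ones. If the lune of an edge `uv` contained two vertices, `uv` could be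
replaced by two disjoint paths through them (`TwoConnected.replace_by_paths`), made of four shorter
edges. If `v` had six neighbours, two of them, `a` and `b`, would satisfy `|ab| < |vb|`, say, and
`vb` could be exchanged for `ab` (`TwoConnected.exchange`). Both contradict minimality.

The one obstruction is a regular hexagon of neighbours, where `|ab| = |va| = |vb|`. So lengths are
compared after a small perturbation that destroys equilateral triangles and keeps strict
inequalities (`exists_generic_perturbation`); it only breaks ties, so the bound `B` and the lunes
still refer to the original locations.

An optimal network exists because there are finitely many graphs and, for each connected one, the
bottleneck is continuous in the Steiner points and large when one of them is far away. -/

/-! ### Six directions in the plane -/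

theorem norm_sub_sq_eq_cos_arg (z w : ℂ) :
    ‖z - w‖ ^ 2 = ‖z‖ ^ 2 + ‖w‖ ^ 2 - 2 * ‖z‖ * ‖w‖ * Real.cos (z.arg - w.arg) := by
  have h1 := Complex.norm_mul_cos_arg z
  have h2 := Complex.norm_mul_sin_arg z
  have h3 := Complex.norm_mul_cos_arg w
  have h4 := Complex.norm_mul_sin_arg w
  have e : ∀ u : ℂ, ‖u‖ ^ 2 = u.re ^ 2 + u.im ^ 2 := fun u => by
    rw [Complex.sq_norm, Complex.normSq_apply]; ring
  rw [Real.cos_sub, e, e z, e w, Complex.sub_re, Complex.sub_im]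
  linear_combination (2 * w.re) * h1 + 2 * ‖z‖ * Real.cos z.arg * h3 + 2 * w.im * h2 +
    2 * ‖z‖ * Real.sin z.arg * h4

/-- By the law of cosines, `‖z - w‖² < ‖z‖² + ‖w‖² - ‖z‖‖w‖`, and the right side is at most the
larger square. -/
theorem norm_sub_lt_max_of_cos {z w : ℂ} (hz : z ≠ 0) (hw : w ≠ 0)
    (h : 1 / 2 < Real.cos (z.arg - w.arg)) : ‖z - w‖ < max ‖z‖ ‖w‖ := by
  have hz' := norm_pos_iff.2 hz
  have hw' := norm_pos_iff.2 hw
  have hp := mul_pos hz' hw'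
  have e := norm_sub_sq_eq_cos_arg z w
  refine lt_of_pow_lt_pow_left₀ 2 (hz'.le.trans (le_max_left _ _)) ?_
  rw [e]
  have : ‖z‖ * ‖w‖ < 2 * ‖z‖ * ‖w‖ * Real.cos (z.arg - w.arg) := by nlinarith
  rcases le_total ‖z‖ ‖w‖ with hl | hl
  · rw [max_eq_right hl]; nlinarith
  · rw [max_eq_left hl]; nlinarith

theorem norm_sub_lt_max_or_equilateral_of_cos {z w : ℂ} (hz : z ≠ 0) (hw : w ≠ 0)
    (h : 1 / 2 ≤ Real.cos (z.arg - w.arg)) :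
    ‖z - w‖ < max ‖z‖ ‖w‖ ∨ (‖z‖ = ‖w‖ ∧ ‖z‖ = ‖z - w‖) := by
  rcases h.lt_or_eq with h | h
  · exact Or.inl (norm_sub_lt_max_of_cos hz hw h)
  have hz' := norm_pos_iff.2 hz
  have hw' := norm_pos_iff.2 hw
  have e := norm_sub_sq_eq_cos_arg z w
  rw [← h] at e
  rcases lt_trichotomy ‖z‖ ‖w‖ with hl | hl | hl
  · left
    rw [max_eq_right hl.le]
    exact lt_of_pow_lt_pow_left₀ 2 hw'.le (by nlinarith)
  · right
    refine ⟨hl, ?_⟩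
    rw [← hl] at e
    exact (pow_left_inj₀ hz'.le (norm_nonneg _) two_ne_zero).1 (by linarith)
  · left
    rw [max_eq_left hl.le]
    exact lt_of_pow_lt_pow_left₀ 2 hz'.le (by nlinarith)

theorem half_lt_cos_of_ceil_eq {x y : ℝ} (h : ⌈x / (Real.pi / 3)⌉ = ⌈y / (Real.pi / 3)⌉) :
    1 / 2 < Real.cos (x - y) := by
  have hpi : 0 < Real.pi / 3 := by positivity
  have h1 := Int.le_ceil (x / (Real.pi / 3))
  have h2 := Int.ceil_lt_add_one (x / (Real.pi / 3))
  have h3 := Int.le_ceil (y / (Real.pi / 3))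
  have h4 := Int.ceil_lt_add_one (y / (Real.pi / 3))
  rw [h] at h1 h2
  have h5 : |x / (Real.pi / 3) - y / (Real.pi / 3)| < 1 := by
    rw [abs_lt]; constructor <;> linarith
  rw [← sub_div, abs_div, abs_of_pos hpi, div_lt_one hpi] at h5
  rw [← Real.cos_abs, ← Real.cos_pi_div_three]
  exact Real.cos_lt_cos_of_nonneg_of_le_pi (abs_nonneg _) (by linarith) h5

/-- Among six nonzero complex numbers there are two that are closer to each other than one of them
is to `0`, or that form an equilateral triangle with `0`. -/
theorem exists_norm_sub_lt_or_equilateral {ι : Type} (s : Finset ι) (hs : s.card = 6) (z : ι → ℂ)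
    (hz : ∀ i ∈ s, z i ≠ 0) :
    ∃ i ∈ s, ∃ j ∈ s, i ≠ j ∧ (‖z i - z j‖ < max ‖z i‖ ‖z j‖ ∨
      (‖z i‖ = ‖z j‖ ∧ ‖z i‖ = ‖z i - z j‖)) := by
  classical
  have hpi : 0 < Real.pi / 3 := by positivity
  obtain ⟨i₀, hi₀⟩ := Finset.card_pos.1 (by omega : 0 < s.card)
  have h0 := hz i₀ hi₀
  -- Rotating one point to argument `0` puts it on the boundary of a half-open sector of width
  -- `π/3`; six such sectors cover `(-π, π]`.
  set t : ι → ℂ := fun i => z i / z i₀ with ht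
  have ht0 : ∀ i ∈ s, t i ≠ 0 := fun i hi => div_ne_zero (hz i hi) h0
  suffices H : ∃ i ∈ s, ∃ j ∈ s, i ≠ j ∧ (‖t i - t j‖ < max ‖t i‖ ‖t j‖ ∨
      (‖t i‖ = ‖t j‖ ∧ ‖t i‖ = ‖t i - t j‖)) by
    obtain ⟨i, hi, j, hj, hij, H⟩ := H
    refine ⟨i, hi, j, hj, hij, ?_⟩
    have hn := norm_pos_iff.2 h0
    simp only [ht, ← sub_div, norm_div] at H
    rw [max_div_div_right hn.le, div_lt_div_iff_of_pos_right hn, div_left_inj' hn.ne',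
      div_left_inj' hn.ne'] at H
    exact H
  set f : ι → ℤ := fun i => ⌈(t i).arg / (Real.pi / 3)⌉ with hf
  by_cases hinj : Set.InjOn f s
  · have hmaps : s.image f ⊆ Finset.Icc (-2) 3 := by
      intro m hm
      obtain ⟨i, _, rfl⟩ := Finset.mem_image.1 hm
      rw [Finset.mem_Icc]
      constructor
      · have : (-3 : ℤ) < f i := by
          rw [hf, Int.lt_ceil, lt_div_iff₀ hpi]
          have := Complex.neg_pi_lt_arg (t i)
          push_cast
          linarith
        omega
      · rw [hf, Int.ceil_le, div_le_iff₀ hpi]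
        have := Complex.arg_le_pi (t i)
        push_cast
        linarith
    have himg : s.image f = Finset.Icc (-2) 3 :=
      Finset.eq_of_subset_of_card_le hmaps (by rw [Finset.card_image_of_injOn hinj, hs]; simp)
    -- All six sectors are occupied, so some point has argument in `(0, π/3]`, at an angle of at
    -- most `π/3` from `t i₀ = 1`.
    have h1 : (1 : ℤ) ∈ s.image f := by rw [himg]; simp
    obtain ⟨j, hj, hfj⟩ := Finset.mem_image.1 h1
    have hti₀ : t i₀ = 1 := div_self h0
    have hfi₀ : f i₀ = 0 := by simp [hf, hti₀]
    refine ⟨i₀, hi₀, j, hj, ?_, ?_⟩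
    · rintro rfl
      omega
    · refine norm_sub_lt_max_or_equilateral_of_cos (ht0 _ hi₀) (ht0 _ hj) ?_
      have h2 : (t j).arg / (Real.pi / 3) ≤ 1 := by
        have := Int.le_ceil ((t j).arg / (Real.pi / 3))
        have h' : ⌈(t j).arg / (Real.pi / 3)⌉ = 1 := hfj
        rw [h'] at this
        exact_mod_cast this
      have h3 : 0 < (t j).arg / (Real.pi / 3) := by
        rw [← Int.ceil_pos]
        have h' : ⌈(t j).arg / (Real.pi / 3)⌉ = 1 := hfj
        omega
      rw [div_le_one hpi] at h2
      have h4 : 0 < (t j).arg := by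
        rcases div_pos_iff.1 h3 with h | h
        · exact h.1
        · linarith [h.2]
      rw [hti₀, Complex.arg_one, zero_sub, Real.cos_neg, ← Real.cos_pi_div_three]
      exact Real.cos_le_cos_of_nonneg_of_le_pi h4.le (by linarith) h2
  · rw [Set.InjOn] at hinj
    push Not at hinj
    obtain ⟨i, hi, j, hj, hij, hne⟩ := hinj
    exact ⟨i, hi, j, hj, hne, Or.inl
      (norm_sub_lt_max_of_cos (ht0 i hi) (ht0 j hj) (half_lt_cos_of_ceil_eq hij))⟩

/-! ### Generic perturbation -/

/-- Every finite point configuration can be moved to a configuration of distinct points without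
equilateral triangles so that all strict inequalities between distances are kept. -/
theorem exists_generic_perturbation {V : Type} [Finite V] (p : V → ℂ) :
    ∃ p' : V → ℂ, (∀ a b c d, dist (p a) (p b) < dist (p c) (p d) →
        dist (p' a) (p' b) < dist (p' c) (p' d)) ∧
      Function.Injective p' ∧
      ∀ v a b, a ≠ v → ¬ (‖p' a - p' v‖ = ‖p' b - p' v‖ ∧ ‖p' a - p' v‖ = ‖p' a - p' b‖) := by
  obtain ⟨n, ⟨e⟩⟩ := Finite.exists_equiv_fin V
  set q : V → ℝ := fun v => ((e v : ℕ) : ℝ) with hq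
  have hqinj : ∀ a b, q a = q b → a = b := fun a b h => by
    simp only [hq, Nat.cast_inj] at h
    exact e.injective (Fin.ext h)
  -- Points slide horizontally at distinct speeds, so squared distances are quadratic in `t` with
  -- leading coefficient the squared difference of speeds.
  set P : ℝ → V → ℂ := fun t v => p v + (t * q v : ℝ) with hP
  have hcont : ∀ v, Continuous fun t => P t v := fun v => by
    simp only [hP]; fun_prop
  have hnear : ∀ᶠ t in nhds (0 : ℝ), ∀ a b c d, dist (p a) (p b) < dist (p c) (p d) →
      dist (P t a) (P t b) < dist (P t c) (P t d) := by
    simp only [Filter.eventually_all]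
    intro a b c d h
    refine ((hcont a).dist (hcont b)).continuousAt.eventually_lt
      ((hcont c).dist (hcont d)).continuousAt ?_
    simpa [hP] using h
  have hsq : ∀ t a b, ‖P t a - P t b‖ ^ 2 = (q a - q b) ^ 2 * t ^ 2 +
      2 * (q a - q b) * (p a - p b).re * t + ‖p a - p b‖ ^ 2 := by
    intro t a b
    simp only [hP, Complex.sq_norm, Complex.normSq_apply, Complex.sub_re, Complex.sub_im,
      Complex.add_re, Complex.add_im, Complex.ofReal_re, Complex.ofReal_im]
    ring
  have hroots : ∀ α β γ : ℝ, α ≠ 0 → {t : ℝ | α * t ^ 2 + β * t + γ = 0}.Finite := by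
    intro α β γ hα
    have hne : (Polynomial.C α * Polynomial.X ^ 2 + Polynomial.C β * Polynomial.X +
        Polynomial.C γ : Polynomial ℝ) ≠ 0 := by
      intro h
      have := congrArg (fun f => f.coeff 2) h
      simp at this
      exact hα this
    refine (Polynomial.finite_setOfPred_isRoot hne).subset fun t ht => ?_
    simpa [Polynomial.IsRoot] using ht
  have hinj : ∀ a b, a ≠ b → {t : ℝ | P t a = P t b}.Finite := by
    intro a b hab
    have hab' : q a - q b ≠ 0 := fun h => hab (hqinj a b (by linarith))
    refine (hroots _ (2 * (q a - q b) * (p a - p b).re) (‖p a - p b‖ ^ 2)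
      (pow_ne_zero 2 hab')).subset fun t ht => ?_
    have := hsq t a b
    rw [Set.mem_ofPred_eq] at ht ⊢
    rw [← this, ht]
    simp
  have hiso : ∀ a b c d, (q a - q b) ^ 2 ≠ (q c - q d) ^ 2 →
      {t : ℝ | ‖P t a - P t b‖ = ‖P t c - P t d‖}.Finite := by
    intro a b c d h
    refine (hroots ((q a - q b) ^ 2 - (q c - q d) ^ 2)
      (2 * (q a - q b) * (p a - p b).re - 2 * (q c - q d) * (p c - p d).re)
      (‖p a - p b‖ ^ 2 - ‖p c - p d‖ ^ 2) (sub_ne_zero.2 h)).subset fun t ht => ?_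
    have h1 := hsq t a b
    have h2 := hsq t c d
    rw [Set.mem_ofPred_eq] at ht ⊢
    rw [ht] at h1
    linarith
  -- Three speeds, not all equal, cannot have equal pairwise differences in absolute value, so one
  -- of the two equations is a genuine quadratic in `t`.
  have htri : ∀ v a b, a ≠ v → {t : ℝ | ‖P t a - P t v‖ = ‖P t b - P t v‖ ∧
      ‖P t a - P t v‖ = ‖P t a - P t b‖}.Finite := by
    intro v a b hav
    have hav' : q a - q v ≠ 0 := fun h => hav (hqinj a v (by linarith))
    by_cases h : (q a - q v) ^ 2 = (q b - q v) ^ 2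
    · by_cases h' : (q a - q v) ^ 2 = (q a - q b) ^ 2
      · exfalso
        rcases sq_eq_sq_iff_eq_or_eq_neg.1 h with h1 | h1
        · have : q a - q b = 0 := by linarith
          rw [this] at h'
          exact hav' (by simpa using h')
        · have : q a - q b = 2 * (q a - q v) := by linarith
          rw [this] at h'
          have h2 : (q a - q v) ^ 2 = 0 := by linarith
          exact hav' (by simpa using h2)
      · exact (hiso _ _ _ _ h').subset fun t ht => ht.2
    · exact (hiso _ _ _ _ h).subset fun t ht => ht.1
  -- The value `t = 0` may itself be bad, hence the punctured neighbourhood.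
  have hgood : ∀ s : Set ℝ, s.Finite → ∀ᶠ t in nhdsWithin (0 : ℝ) {0}ᶜ, t ∉ s := by
    intro s hs
    have h1 : (s \ {0}).Finite := hs.subset Set.sdiff_subset
    have h2 : ∀ᶠ t in nhds (0 : ℝ), t ∈ (s \ {0})ᶜ :=
      h1.isClosed.isOpen_compl.mem_nhds (by simp)
    filter_upwards [nhdsWithin_le_nhds h2, self_mem_nhdsWithin] with t ht ht0 hts
    exact ht ⟨hts, ht0⟩
  have e1 : ∀ᶠ t in nhdsWithin (0 : ℝ) {0}ᶜ, ∀ a b, a ≠ b → ¬ P t a = P t b := by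
    simp only [Filter.eventually_all]
    exact fun a b hab => hgood _ (hinj a b hab)
  have e2 : ∀ᶠ t in nhdsWithin (0 : ℝ) {0}ᶜ, ∀ v a b, a ≠ v →
      ¬ (‖P t a - P t v‖ = ‖P t b - P t v‖ ∧ ‖P t a - P t v‖ = ‖P t a - P t b‖) := by
    simp only [Filter.eventually_all]
    exact fun v a b hav => hgood _ (htri v a b hav)
  obtain ⟨t, h1, h2, h3⟩ := ((hnear.filter_mono nhdsWithin_le_nhds).and (e1.and e2)).exists
  exact ⟨P t, h1, fun a b h => by_contra fun hab => h2 a b hab h, h3⟩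

/-! ### 2-connectivity and edge replacements -/

namespace SimpleGraph

variable {V : Type}

/-- The graph `G` with all edges meeting `S` removed. -/
def avoiding (G : SimpleGraph V) (S : Set V) : SimpleGraph V where
  Adj a b := G.Adj a b ∧ a ∉ S ∧ b ∉ S
  symm := ⟨fun _ _ h => ⟨h.1.symm, h.2.2, h.2.1⟩⟩
  loopless := ⟨fun _ h => h.1.ne rfl⟩

theorem reachable_induce_compl_iff (G : SimpleGraph V) (S : Set V) (a b : V)
    (ha : a ∈ Sᶜ) (hb : b ∈ Sᶜ) :
    (G.induce Sᶜ).Reachable ⟨a, ha⟩ ⟨b, hb⟩ ↔ (G.avoiding S).Reachable a b := by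
  constructor
  · intro h
    exact h.map (G' := G.avoiding S) ⟨fun x => x.1, fun {x y} h => ⟨h, x.2, y.2⟩⟩
  · rintro ⟨w⟩
    induction w with
    | nil => exact Reachable.refl _
    | cons h _ ih =>
      refine Reachable.trans (Adj.reachable ?_) (ih h.2.2 hb)
      exact h.1

end SimpleGraph

open SimpleGraph

/-- Removing a set of at most one vertex treats connectedness and vertex deletion together, and
`avoiding` keeps the vertex type fixed. -/
theorem twoConnected_iff {V : Type} {G : SimpleGraph V} :
    TwoConnected G ↔ Nonempty V ∧ ∀ S : Set V, S.Subsingleton → ∀ a ∉ S, ∀ b ∉ S,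
      (G.avoiding S).Reachable a b := by
  have he : G.avoiding ∅ = G := by ext; simp [avoiding]
  constructor
  · rintro ⟨h1, h2⟩
    refine ⟨h1.nonempty, fun S hS a ha b hb => ?_⟩
    rcases hS.eq_empty_or_singleton with rfl | ⟨x, rfl⟩
    · rw [he]; exact h1.preconnected a b
    · exact (reachable_induce_compl_iff G _ a b ha hb).1 (h2 x _ _)
  · rintro ⟨h1, h2⟩
    refine ⟨⟨fun a b => ?_⟩, fun v a b => ?_⟩
    · simpa [he] using h2 ∅ Set.subsingleton_empty a (by simp) b (by simp)
    · exact (reachable_induce_compl_iff G _ _ _ a.2 b.2).2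
        (h2 _ Set.subsingleton_singleton _ a.2 _ b.2)

/-- A graph is 2-connected as soon as it connects the ends of every edge of a 2-connected graph
after the removal of at most one other vertex. -/
theorem TwoConnected.of_adj_reachable {V : Type} {G H : SimpleGraph V}
    (hG : TwoConnected G)
    (h : ∀ S : Set V, S.Subsingleton → ∀ a ∉ S, ∀ b ∉ S, G.Adj a b →
      (H.avoiding S).Reachable a b) : TwoConnected H := by
  rw [twoConnected_iff] at hG ⊢
  refine ⟨hG.1, fun S hS a ha b hb => ?_⟩
  obtain ⟨w⟩ := hG.2 S hS a ha b hb
  clear ha hb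
  induction w with
  | nil => exact Reachable.refl _
  | cons h' _ ih => exact (h S hS _ h'.2.1 _ h'.2.2 h'.1).trans ih

theorem twoConnected_top {V : Type} [Nonempty V] : TwoConnected (⊤ : SimpleGraph V) := by
  rw [twoConnected_iff]
  refine ⟨inferInstance, fun S _ a ha b hb => ?_⟩
  by_cases hab : a = b
  · subst hab; exact Reachable.refl _
  · exact Adj.reachable ⟨hab, ha, hb⟩

/-- If `D` is closed under stepping in `G` away from `v` and `a`, then a walk of `G - v` from `D` to
`a` only visits `D` before it reaches `a`. -/
theorem reachable_avoiding_of_closed {V : Type} {G H : SimpleGraph V}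
    {v a : V} {D S : Set V}
    (hD : ∀ y ∈ D, ∀ y', G.Adj y y' → y ≠ v → y' ≠ v → y ≠ a → y' ≠ a → y' ∈ D)
    (hS : Disjoint S D) (ha : a ∉ S)
    (hH : ∀ y y', G.Adj y y' → y ≠ v → y' ≠ v → H.Adj y y') {y : V} (hy : y ∈ D)
    (h : (G.avoiding {v}).Reachable y a) : (H.avoiding S).Reachable y a := by
  obtain ⟨w⟩ := h
  induction w with
  | nil => exact Reachable.refl _
  | @cons y y' z hadj w ih =>
    obtain ⟨h1, h2, h3⟩ := hadj
    simp only [Set.mem_singleton_iff] at h2 h3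
    have hyS : y ∉ S := fun h => Set.disjoint_left.1 hS h hy
    by_cases hya : y = z
    · subst hya; exact Reachable.refl _
    by_cases hy'a : y' = z
    · subst hy'a
      exact Adj.reachable ⟨hH _ _ h1 h2 h3, hyS, ha⟩
    have hy' := hD y hy y' h1 h2 h3 hya hy'a
    exact Reachable.trans
      (Adj.reachable ⟨hH _ _ h1 h2 h3, hyS, fun h => Set.disjoint_left.1 hS h hy'⟩) (ih hD ha hy')

/-- Replacing an edge `uv` by two disjoint paths `u w₁ v` and `u w₂ v` keeps a graph 2-connected. -/
theorem TwoConnected.replace_by_paths {V : Type} {G : SimpleGraph V}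
    (hG : TwoConnected G) {u v w₁ w₂ : V}
    (h12 : w₁ ≠ w₂) (h1u : w₁ ≠ u) (h1v : w₁ ≠ v) (h2u : w₂ ≠ u) (h2v : w₂ ≠ v) :
    TwoConnected (G.deleteEdges {s(u, v)} ⊔ fromEdgeSet {s(u, w₁), s(w₁, v), s(u, w₂), s(w₂, v)}) := by
  refine hG.of_adj_reachable fun S hS a ha b hb hab => ?_
  have key : ∀ w, (w = w₁ ∨ w = w₂) → u ∉ S → v ∉ S → w ∉ S →
      ((G.deleteEdges {s(u, v)} ⊔
        fromEdgeSet {s(u, w₁), s(w₁, v), s(u, w₂), s(w₂, v)}).avoiding S).Reachable u v := by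
    intro w hw hu hv hwS
    refine Reachable.trans (v := w) (Adj.reachable ⟨?_, hu, hwS⟩) (Adj.reachable ⟨?_, hwS, hv⟩) <;>
    · rcases hw with rfl | rfl <;> simp [h1u, h1v, h2u, h2v, h1u.symm, h2u.symm]
  -- At most one vertex is removed, so one of the two paths survives.
  have key' : u ∉ S → v ∉ S → ((G.deleteEdges {s(u, v)} ⊔
        fromEdgeSet {s(u, w₁), s(w₁, v), s(u, w₂), s(w₂, v)}).avoiding S).Reachable u v := by
    intro hu hv
    by_cases h1 : w₁ ∈ S
    · exact key w₂ (Or.inr rfl) hu hv fun h2 => h12 (hS h1 h2)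
    · exact key w₁ (Or.inl rfl) hu hv h1
  by_cases he : s(a, b) = s(u, v)
  · rcases Sym2.eq_iff.1 he with ⟨rfl, rfl⟩ | ⟨rfl, rfl⟩
    · exact key' ha hb
    · exact (key' hb ha).symm
  · refine Adj.reachable ⟨Or.inl ?_, ha, hb⟩
    rw [deleteEdges_adj]
    exact ⟨hab, he⟩

/-- In a minimally 2-connected graph, an edge `vb` can be exchanged for `ab`, where `a` is another
neighbour of `v`, provided that `v` has a third neighbour. -/
theorem TwoConnected.exchange {V : Type} {G : SimpleGraph V} (hG : TwoConnected G)
    {v a b c : V}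
    (hva : G.Adj v a) (hvb : G.Adj v b) (hvc : G.Adj v c) (hab : a ≠ b) (hca : c ≠ a) (hcb : c ≠ b)
    (hmin : ¬ TwoConnected (G.deleteEdges {s(v, a)})) :
    TwoConnected (G.deleteEdges {s(v, b)} ⊔ fromEdgeSet {s(a, b)}) := by
  by_contra hcon
  have hG' := twoConnected_iff.1 hG
  -- Unless `a` is removed, the path `v a b` makes up for the lost edge `vb`; so a failure means
  -- that `a` separates `v` from `b` once `vb` is deleted.
  have hsep : ¬ ((G.deleteEdges {s(v, b)}).avoiding {a}).Reachable v b := by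
    intro hr
    apply hcon
    have key : ∀ S : Set V, S.Subsingleton → v ∉ S → b ∉ S →
        ((G.deleteEdges {s(v, b)} ⊔ fromEdgeSet {s(a, b)}).avoiding S).Reachable v b := by
      intro S hS hv hb
      by_cases ha : a ∈ S
      · obtain rfl : S = {a} := hS.eq_singleton_of_mem ha
        refine hr.mono ?_
        intro x y hxy
        exact ⟨Or.inl hxy.1, hxy.2⟩
      · refine Reachable.trans (v := a) (Adj.reachable ⟨Or.inl ?_, hv, ha⟩)
          (Adj.reachable ⟨Or.inr ?_, ha, hb⟩)
        · rw [deleteEdges_adj]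
          refine ⟨hva, ?_⟩
          simp [hab, hva.ne.symm]
        · simp [hab]
    refine hG.of_adj_reachable fun S hS x hx y hy hxy => ?_
    by_cases he : s(x, y) = s(v, b)
    · rcases Sym2.eq_iff.1 he with ⟨rfl, rfl⟩ | ⟨rfl, rfl⟩
      · exact key S hS hx hy
      · exact (key S hS hy hx).symm
    · refine Adj.reachable ⟨Or.inl ?_, hx, hy⟩
      rw [deleteEdges_adj]
      exact ⟨hxy, he⟩
  apply hmin
  -- `C` is the side of `v` in that separation: it contains `c` but not `b`. Both sides lead to `a`
  -- without using `v`, so `va` is redundant, contrary to `hmin`.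
  set C : Set V := {y | ((G.deleteEdges {s(v, b)}).avoiding {a}).Reachable v y} with hC
  have hstep : ∀ y ∈ C, ∀ y', G.Adj y y' → s(y, y') ≠ s(v, b) → y ≠ a → y' ≠ a → y' ∈ C := by
    intro y hy y' hadj hne h1 h2
    refine Reachable.trans hy (Adj.reachable ⟨?_, h1, h2⟩)
    rw [deleteEdges_adj]
    exact ⟨hadj, hne⟩
  have hvC : v ∈ C := Reachable.refl _
  have hcC : c ∈ C := hstep v hvC c hvc (by simp [hcb, hvb.ne]) hva.ne hca
  have hne : ∀ y y' : V, y ≠ v → y' ≠ v → ∀ z, s(y, y') ≠ s(v, z) := by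
    intro y y' h1 h2 z h
    rcases Sym2.eq_iff.1 h with ⟨h, _⟩ | ⟨_, h⟩
    · exact h1 h
    · exact h2 h
  have hH : ∀ y y', G.Adj y y' → y ≠ v → y' ≠ v → (G.deleteEdges {s(v, a)}).Adj y y' := by
    intro y y' h h1 h2
    rw [deleteEdges_adj]
    exact ⟨h, hne y y' h1 h2 a⟩
  have key : ∀ S : Set V, S.Subsingleton → v ∉ S → a ∉ S →
      ((G.deleteEdges {s(v, a)}).avoiding S).Reachable v a := by
    intro S hS hv ha
    -- If the removed vertex is not in `C`, go from `v` through `c` inside `C` to `a`; otherwise go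
    -- through `b` outside `C`.
    by_cases hSC : Disjoint S C
    · refine Reachable.trans (v := c)
        (Adj.reachable ⟨?_, hv, fun h => Set.disjoint_left.1 hSC h hcC⟩)
        (reachable_avoiding_of_closed (G := G) (v := v) (D := C) ?_ hSC ha hH hcC
          (hG'.2 _ Set.subsingleton_singleton _ hvc.ne.symm _ hva.ne.symm))
      · rw [deleteEdges_adj]; exact ⟨hvc, by simp [hca, hva.ne]⟩
      · intro y hy y' h h1 h2 h3 h4
        exact hstep y hy y' h (hne y y' h1 h2 b) h3 h4
    · obtain ⟨x, hxS, hxC⟩ := Set.not_disjoint_iff.1 hSC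
      obtain rfl : S = {x} := hS.eq_singleton_of_mem hxS
      have hbC : b ∈ Cᶜ := hsep
      refine Reachable.trans (v := b)
        (Adj.reachable ⟨?_, hv, fun h => ?_⟩)
        (reachable_avoiding_of_closed (G := G) (v := v) (D := Cᶜ) ?_ ?_ ha hH hbC
          (hG'.2 _ Set.subsingleton_singleton _ hvb.ne.symm _ hva.ne.symm))
      · rw [deleteEdges_adj]; exact ⟨hvb, by simp [hab.symm, hva.ne]⟩
      · rw [Set.mem_singleton_iff] at h
        subst h
        exact hbC hxC
      · intro y hy y' h h1 h2 h3 h4 h5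
        exact hy (hstep y' h5 y h.symm (hne y' y h2 h1 b) h4 h3)
      · simpa using hxC
  refine hG.of_adj_reachable fun S hS x hx y hy hxy => ?_
  by_cases he : s(x, y) = s(v, a)
  · rcases Sym2.eq_iff.1 he with ⟨rfl, rfl⟩ | ⟨rfl, rfl⟩
    · exact key S hS hx hy
    · exact (key S hS hy hx).symm
  · refine Adj.reachable ⟨?_, hx, hy⟩
    rw [deleteEdges_adj]
    exact ⟨hxy, he⟩

/-! ### The weight to be minimised -/

/-- The number of ordered pairs of vertices that are strictly closer together than `q`. -/
noncomputable def distRank {V : Type} [Fintype V] (p : V → ℂ) (q : V × V) : ℕ :=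
  (Finset.univ.filter fun r : V × V => dist (p r.1) (p r.2) < dist (p q.1) (p q.2)).card

theorem distRank_lt {V : Type} [Fintype V] {p : V → ℂ} {q r : V × V}
    (h : dist (p q.1) (p q.2) < dist (p r.1) (p r.2)) : distRank p q < distRank p r := by
  refine Finset.card_lt_card (Finset.ssubset_iff_of_subset ?_ |>.2 ⟨q, ?_, ?_⟩)
  · intro x hx
    simp only [Finset.mem_filter, Finset.mem_univ, true_and] at hx ⊢
    exact hx.trans h
  · simpa using h
  · simp

open Classical in
/-- A weight of a graph in which an edge outweighs any four shorter edges. -/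
noncomputable def distWeight {V : Type} [Fintype V] (p : V → ℂ) (G : SimpleGraph V) : ℕ :=
  ∑ q : V × V with G.Adj q.1 q.2, 9 ^ distRank p q

-- Edges are counted as ordered pairs, so four new edges are eight terms, each at most `9 ^ (m - 1)`
-- with `m` the rank of `uv`; their sum is below `9 ^ m`.
open Classical in
theorem distWeight_lt {V : Type} [Fintype V] {p : V → ℂ} {G H : SimpleGraph V} {u v : V}
    (huv : G.Adj u v) {F : Finset (V × V)} (hF : F.card ≤ 8)
    (hlt : ∀ q ∈ F, dist (p q.1) (p q.2) < dist (p u) (p v))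
    (hH : ∀ a b, H.Adj a b → (G.Adj a b ∧ s(a, b) ≠ s(u, v)) ∨ (a, b) ∈ F) :
    distWeight p H < distWeight p G := by
  set E : Finset (V × V) := Finset.univ.filter fun q : V × V => G.Adj q.1 q.2 with hE
  have hmem : (u, v) ∈ E := by simpa [hE] using huv
  have hsub : (Finset.univ.filter fun q : V × V => H.Adj q.1 q.2) ⊆ E.erase (u, v) ∪ F := by
    rintro ⟨a, b⟩ h
    simp only [Finset.mem_filter, Finset.mem_univ, true_and] at h
    rcases hH a b h with h | h
    · refine Finset.mem_union_left _ (Finset.mem_erase.2 ⟨?_, by simpa [hE] using h.1⟩)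
      rintro h'
      rw [Prod.mk.injEq] at h'
      exact h.2 (by rw [h'.1, h'.2])
    · exact Finset.mem_union_right _ h
  have h1 : ∑ q ∈ F, 9 ^ distRank p q < 9 ^ distRank p (u, v) := by
    rcases F.eq_empty_or_nonempty with rfl | ⟨q, hq⟩
    · simp
    · have hpos : 0 < distRank p (u, v) := lt_of_le_of_lt (Nat.zero_le _)
        (distRank_lt (q := q) (r := (u, v)) (hlt q hq))
      obtain ⟨r, hr⟩ := Nat.exists_eq_succ_of_ne_zero hpos.ne'
      calc ∑ q ∈ F, 9 ^ distRank p q ≤ ∑ q ∈ F, 9 ^ r := by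
            refine Finset.sum_le_sum fun q hq => Nat.pow_le_pow_right (by norm_num) ?_
            have := distRank_lt (q := q) (r := (u, v)) (hlt q hq)
            omega
        _ = F.card * 9 ^ r := by simp
        _ ≤ 8 * 9 ^ r := Nat.mul_le_mul_right _ hF
        _ < 9 ^ distRank p (u, v) := by
            rw [hr, pow_succ]
            have : 0 < 9 ^ r := by positivity
            omega
  calc distWeight p H ≤ ∑ q ∈ E.erase (u, v) ∪ F, 9 ^ distRank p q :=
        Finset.sum_le_sum_of_subset hsub
    _ ≤ ∑ q ∈ E.erase (u, v), 9 ^ distRank p q + ∑ q ∈ F, 9 ^ distRank p q := by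
        rw [← Finset.sum_union_inter]; exact Nat.le_add_right _ _
    _ < ∑ q ∈ E.erase (u, v), 9 ^ distRank p q + 9 ^ distRank p (u, v) :=
        Nat.add_lt_add_left h1 _
    _ = distWeight p G := Finset.sum_erase_add _ _ hmem

/-! ### Minimal graphs lie in the 2-RNG and have degree at most five -/

/-- A drawn 2-connected graph can be replaced, on the same vertices and without longer edges, by a
2-connected subgraph of the 2-RNG of maximum degree at most five. -/
theorem exists_twoConnected_le_twoRNG {V : Type} [Finite V] (p : V → Plane) {B : ℝ}
    {G₀ : SimpleGraph V} (hG₀ : TwoConnected G₀) (hB : ∀ a b, G₀.Adj a b → dist (p a) (p b) ≤ B) :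
    ∃ G : SimpleGraph V, TwoConnected G ∧ (∀ a b, G.Adj a b → dist (p a) (p b) ≤ B) ∧
      G ≤ twoRNG p ∧ ∀ v, (G.neighborSet v).encard ≤ 5 := by
  classical
  have : Fintype V := Fintype.ofFinite V
  obtain ⟨p', hp', hinj, htri⟩ := exists_generic_perturbation
    fun v => Complex.orthonormalBasisOneI.repr.symm (p v)
  simp only [LinearIsometryEquiv.dist_map] at hp'
  -- A strict inequality after perturbation may come from a tie, but never reverses an original
  -- strict one; this keeps the bound `B`.
  have hle : ∀ a b c d, dist (p' a) (p' b) < dist (p' c) (p' d) →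
      dist (p a) (p b) ≤ dist (p c) (p d) := fun a b c d h =>
    not_lt.1 fun h' => lt_asymm h (hp' _ _ _ _ h')
  obtain ⟨G, ⟨hG, hGB⟩, hmin⟩ := exists_minimalFor_of_wellFoundedLT
    (fun G : SimpleGraph V => TwoConnected G ∧ ∀ a b, G.Adj a b → dist (p a) (p b) ≤ B)
    (distWeight p') ⟨G₀, hG₀, hB⟩
  have hno : ∀ (H : SimpleGraph V) (u v : V), G.Adj u v → TwoConnected H →
      ∀ F : Finset (V × V), F.card ≤ 8 →
      (∀ q ∈ F, dist (p' q.1) (p' q.2) < dist (p' u) (p' v)) →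
      ¬ ∀ a b, H.Adj a b → (G.Adj a b ∧ s(a, b) ≠ s(u, v)) ∨ (a, b) ∈ F := by
    intro H u v huv hH F hF hlt hsub
    have hw := distWeight_lt huv hF hlt hsub
    refine absurd (hmin ⟨hH, fun a b hab => ?_⟩ hw.le) (not_le.2 hw)
    rcases hsub a b hab with h | h
    · exact hGB a b h.1
    · exact (hle _ _ _ _ (hlt _ h)).trans (hGB u v huv)
  have hdel : ∀ u v, G.Adj u v → ¬ TwoConnected (G.deleteEdges {s(u, v)}) := by
    intro u v huv h
    refine hno _ u v huv h ∅ (by simp) (by simp) fun a b hab => Or.inl ?_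
    rwa [deleteEdges_adj] at hab
  have hexch : ∀ v a b c, G.Adj v a → G.Adj v b → G.Adj v c → a ≠ b → c ≠ a → c ≠ b →
      ¬ dist (p' a) (p' b) < dist (p' v) (p' b) := by
    intro v a b c hva hvb hvc hab hca hcb hlt
    refine hno _ v b hvb (hG.exchange hva hvb hvc hab hca hcb (hdel v a hva)) {(a, b), (b, a)}
      (Finset.card_le_two.trans (by norm_num)) ?_ ?_
    · intro q hq
      simp only [Finset.mem_insert, Finset.mem_singleton] at hq
      rcases hq with rfl | rfl
      · exact hlt
      · rwa [_root_.dist_comm (p' b)]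
    · intro x y hxy
      rw [sup_adj, deleteEdges_adj, fromEdgeSet_adj] at hxy
      rcases hxy with h | ⟨h, _⟩
      · exact Or.inl h
      · right
        simpa using h
  refine ⟨G, hG, hGB, ?_, ?_⟩
  · intro u v huv
    refine ⟨huv.ne, not_le.1 fun h => ?_⟩
    obtain ⟨w₁, h₁, w₂, h₂, h12⟩ := Set.one_lt_encard_iff_nontrivial.1
      (lt_of_lt_of_le (by norm_num) h)
    have key : ∀ w, p w ∈ lune (p u) (p v) → w ≠ u ∧ w ≠ v ∧
        dist (p' w) (p' u) < dist (p' u) (p' v) ∧ dist (p' w) (p' v) < dist (p' u) (p' v) := by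
      rintro w ⟨hu, hv⟩
      rw [Metric.mem_ball] at hu hv
      refine ⟨?_, ?_, hp' _ _ _ _ hu, hp' _ _ _ _ hv⟩
      · rintro rfl
        exact lt_irrefl _ hv
      · rintro rfl
        rw [_root_.dist_comm] at hu
        exact lt_irrefl _ hu
    obtain ⟨h1u, h1v, d1u, d1v⟩ := key w₁ h₁
    obtain ⟨h2u, h2v, d2u, d2v⟩ := key w₂ h₂
    refine hno _ u v huv (hG.replace_by_paths h12 h1u h1v h2u h2v)
      {(u, w₁), (w₁, u), (w₁, v), (v, w₁), (u, w₂), (w₂, u), (w₂, v), (v, w₂)}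
      ?_ ?_ ?_
    · exact (Finset.card_insert_le _ _).trans (Nat.succ_le_succ ((Finset.card_insert_le _ _).trans
        (Nat.succ_le_succ Finset.card_le_six)))
    · intro q hq
      simp only [Finset.mem_insert, Finset.mem_singleton] at hq
      have c := fun x y => _root_.dist_comm (p' x) (p' y)
      rcases hq with rfl | rfl | rfl | rfl | rfl | rfl | rfl | rfl
      · simpa only [c u w₁] using d1u
      · exact d1u
      · exact d1v
      · simpa only [c v w₁] using d1v
      · simpa only [c u w₂] using d2u
      · exact d2u
      · exact d2v
      · simpa only [c v w₂] using d2v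
    · intro x y hxy
      rw [sup_adj, deleteEdges_adj, fromEdgeSet_adj] at hxy
      rcases hxy with h | ⟨h, _⟩
      · exact Or.inl h
      · right
        simp only [Set.mem_insert_iff, Set.mem_singleton_iff, Sym2.eq_iff] at h
        simp only [Finset.mem_insert, Finset.mem_singleton, Prod.mk.injEq]
        tauto
  · intro v
    by_contra! h
    obtain ⟨t, ht, htc⟩ := Set.exists_subset_encard_eq (Order.add_one_le_of_lt h)
    have htf : t.Finite := Set.toFinite t
    have hcard : htf.toFinset.card = 6 := by
      rw [← htf.coe_toFinset, Set.encard_coe_eq_coe_finsetCard] at htc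
      exact Nat.cast_inj.1 (htc.trans (by norm_num : (5 : ℕ∞) + 1 = ((6 : ℕ) : ℕ∞)))
    have hadj : ∀ i ∈ htf.toFinset, G.Adj v i := fun i hi => ht (htf.mem_toFinset.1 hi)
    obtain ⟨a, ha, b, hb, hab, H⟩ := exists_norm_sub_lt_or_equilateral htf.toFinset hcard
      (fun i => p' i - p' v) fun i hi => sub_ne_zero.2 fun h => (hadj i hi).ne (hinj h).symm
    -- Any of the other four neighbours serves as the third neighbour that the exchange needs.
    obtain ⟨c, hc, hc'⟩ := Finset.exists_mem_notMem_of_card_lt_card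
      (s := {a, b}) (t := htf.toFinset) (by
        rw [hcard]; exact Finset.card_le_two.trans_lt (by norm_num))
    simp only [Finset.mem_insert, Finset.mem_singleton, not_or] at hc'
    rw [sub_sub_sub_cancel_right] at H
    rcases H with H | H
    · rcases lt_max_iff.1 H with H | H
      · refine hexch v b a c (hadj b hb) (hadj a ha) (hadj c hc) hab.symm hc'.2 hc'.1 ?_
        rwa [_root_.dist_comm, _root_.dist_comm (p' v), dist_eq_norm, dist_eq_norm]
      · refine hexch v a b c (hadj a ha) (hadj b hb) (hadj c hc) hab hc'.1 hc'.2 ?_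
        rwa [_root_.dist_comm (p' v), dist_eq_norm, dist_eq_norm]
    · exact htri v a b (hadj a ha).ne.symm H

/-! ### Bottleneck length as a function of the locations -/

theorem finite_edgeLengths {V : Type} [Finite V] (p : V → Plane) (G : SimpleGraph V) :
    {r : ℝ | ∃ u v : V, G.Adj u v ∧ r = dist (p u) (p v)}.Finite := by
  refine (Set.finite_range fun q : V × V => dist (p q.1) (p q.2)).subset ?_
  rintro r ⟨u, v, _, rfl⟩
  exact ⟨(u, v), rfl⟩

theorem dist_le_maxEdgeLength {V : Type} [Finite V] (p : V → Plane) {G : SimpleGraph V} {u v : V}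
    (h : G.Adj u v) :
    dist (p u) (p v) ≤ maxEdgeLength p G :=
  le_csSup (finite_edgeLengths p G).bddAbove ⟨u, v, h, rfl⟩

theorem maxEdgeLength_nonneg {V : Type} (p : V → Plane) (G : SimpleGraph V) : 0 ≤ maxEdgeLength p G := by
  refine Real.sSup_nonneg ?_
  rintro r ⟨u, v, _, rfl⟩
  exact dist_nonneg

theorem maxEdgeLength_le {V : Type} {p : V → Plane} {G : SimpleGraph V} {B : ℝ} (hB : 0 ≤ B)
    (h : ∀ u v, G.Adj u v → dist (p u) (p v) ≤ B) : maxEdgeLength p G ≤ B := by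
  refine Real.sSup_le ?_ hB
  rintro r ⟨u, v, huv, rfl⟩
  exact h u v huv

theorem dist_le_length_mul_maxEdgeLength {V : Type} [Finite V] (p : V → Plane) {G : SimpleGraph V}
    {u v : V} (w : G.Walk u v) : dist (p u) (p v) ≤ w.length * maxEdgeLength p G := by
  induction w with
  | nil => simp
  | @cons x y z h w ih =>
    rw [Walk.length_cons, Nat.cast_add, Nat.cast_one, add_mul, one_mul, add_comm]
    exact (dist_triangle _ (p y) _).trans (add_le_add (dist_le_maxEdgeLength p h) ih)

theorem maxEdgeLength_le_add {V : Type} [Finite V] {p p' : V → Plane} (G : SimpleGraph V) {δ : ℝ}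
    (hδ : 0 ≤ δ) (h : ∀ v, dist (p v) (p' v) ≤ δ) :
    maxEdgeLength p G ≤ maxEdgeLength p' G + 2 * δ := by
  refine maxEdgeLength_le (by have := maxEdgeLength_nonneg p' G; linarith) fun u v huv => ?_
  have h1 := dist_triangle4 (p u) (p' u) (p' v) (p v)
  have h2 := dist_le_maxEdgeLength p' huv
  have h3 := h u
  have h4 := h v
  rw [_root_.dist_comm] at h4
  linarith

/-! ### Existence of optimal networks -/

namespace SteinerNetwork

variable {X : Finset Plane} {k : ℕ}

theorem dist_sumElim_le (s s' : Fin k → Plane) (v : ↥X ⊕ Fin k) :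
    dist (Sum.elim (fun x : ↥X => (x : Plane)) s v) (Sum.elim (fun x : ↥X => (x : Plane)) s' v) ≤
      dist s s' := by
  cases v with
  | inl x => simp
  | inr i => exact dist_le_pi_dist s s' i

theorem continuous_maxEdgeLength (G : SimpleGraph (↥X ⊕ Fin k)) :
    Continuous fun s : Fin k → Plane =>
      maxEdgeLength (Sum.elim (fun x : ↥X => (x : Plane)) s) G := by
  refine (LipschitzWith.of_le_add_mul 2 fun s s' => ?_).continuous
  exact maxEdgeLength_le_add G dist_nonneg (dist_sumElim_le s s')

/-- A walk from each Steiner point to a fixed `x₀ ∈ X` bounds its distance to `x₀` by the walk's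
length times the bottleneck. Hence locations that beat putting all Steiner points at `x₀` lie in a
compact product of discs. -/
theorem exists_forall_maxEdgeLength_le (hX : X.Nonempty) {G : SimpleGraph (↥X ⊕ Fin k)}
    (hG : G.Connected) : ∃ s : Fin k → Plane, ∀ s' : Fin k → Plane,
      maxEdgeLength (Sum.elim (fun x : ↥X => (x : Plane)) s) G ≤
        maxEdgeLength (Sum.elim (fun x : ↥X => (x : Plane)) s') G := by
  obtain ⟨x₀, hx₀⟩ := hX
  set f : (Fin k → Plane) → ℝ := fun s =>
    maxEdgeLength (Sum.elim (fun x : ↥X => (x : Plane)) s) G with hf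
  refine (continuous_maxEdgeLength G).exists_forall_le' (fun _ => x₀) ?_
  have w : ∀ i : Fin k, G.Walk (Sum.inr i) (Sum.inl ⟨x₀, hx₀⟩) :=
    fun i => (hG.preconnected _ _).some
  have hK : IsCompact (Set.pi Set.univ fun i : Fin k =>
      Metric.closedBall x₀ ((w i).length * f fun _ => x₀)) :=
    isCompact_univ_pi fun i => isCompact_closedBall _ _
  refine Filter.Eventually.mono (Filter.eventually_of_mem hK.compl_mem_cocompact fun _ h => h)
    fun s hs => ?_
  by_contra! hlt
  refine hs fun i _ => ?_
  rw [Metric.mem_closedBall]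
  exact (dist_le_length_mul_maxEdgeLength (Sum.elim (fun x : ↥X => (x : Plane)) s) (w i)).trans
    (mul_le_mul_of_nonneg_left hlt.le (Nat.cast_nonneg _))

theorem exists_isMBSN (hX : X.Nonempty) : ∃ N : SteinerNetwork X k, N.IsMBSN := by
  obtain ⟨x₀, hx₀⟩ := hX
  have : Nonempty (↥X ⊕ Fin k) := ⟨Sum.inl ⟨x₀, hx₀⟩⟩
  choose s hs using fun G : {G : SimpleGraph (↥X ⊕ Fin k) // TwoConnected G} =>
    exists_forall_maxEdgeLength_le ⟨x₀, hx₀⟩ G.2.1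
  have : Nonempty {G : SimpleGraph (↥X ⊕ Fin k) // TwoConnected G} := ⟨⟨⊤, twoConnected_top⟩⟩
  obtain ⟨G, hG⟩ := Finite.exists_min
    fun G => maxEdgeLength (Sum.elim (fun x : ↥X => (x : Plane)) (s G)) G.1
  exact ⟨⟨s G, G.1, G.2⟩, fun N => (hG ⟨N.graph, N.twoConnected⟩).trans (hs _ N.steiner)⟩

/-- Keeping the Steiner points, every network can be changed into a subgraph of its 2-RNG of maximum
degree at most five without increasing the bottleneck. -/
theorem exists_improved (N : SteinerNetwork X k) : ∃ N' : SteinerNetwork X k,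
    N'.steiner = N.steiner ∧ N'.bottleneck ≤ N.bottleneck ∧ N'.IsSubgraphOfTwoRNG ∧
      N'.MaxDegreeLE 5 := by
  obtain ⟨G, hG, hB, hRNG, hdeg⟩ := exists_twoConnected_le_twoRNG N.pos N.twoConnected
    fun _ _ h => dist_le_maxEdgeLength N.pos h
  exact ⟨⟨N.steiner, G, hG⟩, rfl, maxEdgeLength_le (maxEdgeLength_nonneg _ _) hB, hRNG, hdeg⟩

end SteinerNetwork

theorem proposition1 (X : Finset Plane) (hX : 2 ≤ X.card) (k : ℕ) :
    (∃ N : SteinerNetwork X k,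
      N.IsMBSN ∧ N.IsSubgraphOfTwoRNG ∧ N.MaxDegreeLE 5) ∧
    ((∃ N : SteinerNetwork X k, N.IsProperMBSN) →
      ∃ N : SteinerNetwork X k,
        N.IsProperMBSN ∧ N.IsSubgraphOfTwoRNG ∧ N.MaxDegreeLE 5) := by
  constructor
  · obtain ⟨N, hN⟩ := SteinerNetwork.exists_isMBSN (k := k) (Finset.card_pos.1 (by omega : 0 < X.card))
    obtain ⟨N', _, hle, h⟩ := N.exists_improved
    exact ⟨N', fun M => hle.trans (hN M), h⟩
  · rintro ⟨N, hN, hmin⟩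
    obtain ⟨N', hs, hle, h⟩ := N.exists_improved
    refine ⟨N', ⟨?_, fun M hM => hle.trans (hmin M hM)⟩, h⟩
    rwa [SteinerNetwork.IsProper, SteinerNetwork.pos, hs]
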